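/- Let $\mathbb{F}_q$ be a finite field and let $n,k,\ell$ be positive integers with $k<n$ and $\min\{k,n-k\}\ge 3$. Let $\alpha_1,\dots,\alpha_n\in\mathbb{F}_q$ be distinct, and let $t=(t_1,\dots,t_\ell)\in\{1,\dots,n-k\}^\ell$ and $h=(h_1,\dots,h_\ell)\in\{0,\dots,k-1\}^\ell$ be such that the pairs $(h_j,t_j)$ are pairwise distinct. For $\eta\in\mathbb{F}_q^\ell$ let $$\mathcal{P}_\eta=\Big\{\sum_{i=0}^{k-1}f_iX^i+\sum_{j=1}^{\ell}\eta_j f_{h_j}X^{k-1+t_j}\ :\ f_0,\dots,f_{k-1}\in\mathbb{F}_q\Big\},$$ and let the twisted Reed--Solomon code with coefficient vector $\eta$ be $$\mathcal{C}_\eta=\{(f(\alpha_1),\dots,f(\alpha_n)) : f\in\mathcal{P}_\eta\}\subseteq\mathbb{F}_q^n .$$ A linear code of length $n$, dimension $k'$ and minimum Hamming distance $d$ is called MDS if $d=n-k'+1$. A code $\mathcal{C}\subseteq\mathbb{F}_q^n$ is called GRS if there are an integer $0\le k'\le n$, distinct $\beta_1,\dots,\beta_n\in\mathbb{F}_q$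 and nonzero $v_1,\dots,v_n\in\mathbb{F}_q$ with $\mathcal{C}=\{(v_1f(\beta_1),\dots,v_nf(\beta_n)) : f\in\mathbb{F}_q[X],\ \deg f<k'\}$ (with $\deg 0=-\infty$). Let $\mathcal{H}\subseteq\mathbb{F}_q^\ell$ be the set of all $\eta$ for which $\mathcal{C}_\eta$ is MDS, and assume that there is an $\eta^*\in\mathcal{H}$ for which $\mathcal{C}_{\eta^*}$ is not GRS. Then there is a nonzero polynomial $P\in\mathbb{F}_q[X_1,\dots,X_\ell]$, of degree at most $6$ in each variable, such that $P(\eta)=0$ for every $\eta\in\mathcal{H}$ for which $\mathcal{C}_\eta$ is GRS. -/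

import Mathlib

noncomputable section

namespace TwistedRS

open Polynomial

/-- The evaluation map `f ↦ [f(α₁), …, f(αₙ)]`. -/
def evalMap {F : Type*} [Field F] {n : ℕ} (α : Fin n → F) : F[X] →ₗ[F] (Fin n → F) :=
  LinearMap.pi fun i => Polynomial.leval (α i)

/-- The polynomial `∑_{i<k} fᵢ Xⁱ + ∑ⱼ ηⱼ f_{hⱼ} X^{k-1+tⱼ}` with coefficient vector `f`. -/
def twistedPoly {F : Type*} [Field F] {k ℓ : ℕ} (t : Fin ℓ → ℕ) (h : Fin ℓ → Fin k)
    (η : Fin ℓ → F) (f : Fin k → F) : F[X] :=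
  ∑ i : Fin k, C (f i) * X ^ (i : ℕ) + ∑ j : Fin ℓ, C (η j * f (h j)) * X ^ (k - 1 + t j)

/-- The space of twisted polynomials with twist vector `t`, hook vector `h` and
coefficient vector `η`. -/
def twistedPolynomials {F : Type*} [Field F] {k ℓ : ℕ} (t : Fin ℓ → ℕ) (h : Fin ℓ → Fin k)
    (η : Fin ℓ → F) : Submodule F F[X] where
  carrier := {p | ∃ f : Fin k → F, p = twistedPoly t h η f}
  zero_mem' := ⟨0, by simp [twistedPoly]⟩
  add_mem' := by
    rintro _ _ ⟨f, rfl⟩ ⟨g, rfl⟩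
    refine ⟨f + g, ?_⟩
    simp only [twistedPoly, Pi.add_apply, mul_add, map_add, add_mul, Finset.sum_add_distrib]
    ring
  smul_mem' := by
    rintro c _ ⟨f, rfl⟩
    refine ⟨c • f, ?_⟩
    simp only [twistedPoly, Polynomial.smul_eq_C_mul, Pi.smul_apply, smul_eq_mul, mul_add,
      Finset.mul_sum, map_mul]
    congr 1 <;> refine Finset.sum_congr rfl fun i _ => ?_ <;> ring

/-- The twisted Reed--Solomon code: the evaluations at `α` of the twisted polynomials. -/
def twistedRSCode {F : Type*} [Field F] {n k ℓ : ℕ} (α : Fin n → F) (t : Fin ℓ → ℕ)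
    (h : Fin ℓ → Fin k) (η : Fin ℓ → F) : Submodule F (Fin n → F) :=
  (twistedPolynomials t h η).map (evalMap α)

/-- `ev_β(F[X]_{<k}) · diag(v₁, …, vₙ)`. -/
def grsCode {F : Type*} [Field F] {n : ℕ} (k : ℕ) (β v : Fin n → F) :
    Submodule F (Fin n → F) :=
  ((Polynomial.degreeLT F k).map (evalMap β)).map (Matrix.vecMulLinear (Matrix.diagonal v))

/-- A linear code is a generalized Reed--Solomon code if it is given by some distinct evaluation
points and some nonzero column multipliers. -/
def IsGRS {F : Type*} [Field F] {n : ℕ} (𝒞 : Submodule F (Fin n → F)) : Prop :=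
  ∃ k : ℕ, k ≤ n ∧ ∃ β v : Fin n → F,
    Function.Injective β ∧ (∀ i, v i ≠ 0) ∧ 𝒞 = grsCode k β v

/-- The minimum Hamming distance between distinct codewords. -/
def minDist {F : Type*} [Field F] [DecidableEq F] {n : ℕ} (𝒞 : Submodule F (Fin n → F)) : ℕ :=
  sInf {d | ∃ x ∈ 𝒞, ∃ y ∈ 𝒞, x ≠ y ∧ hammingDist x y = d}

/-- A linear code is MDS if it meets the Singleton bound, `d = n - dim + 1`. -/
def IsMDS {F : Type*} [Field F] [DecidableEq F] {n : ℕ} (𝒞 : Submodule F (Fin n → F)) : Prop :=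
  minDist 𝒞 = n - Module.finrank F 𝒞 + 1

end TwistedRS

end

namespace TwistedRS

open Polynomial

/-! ### GRS codes, systematic generators and Cauchy matrices. -/

section Codes

variable {F : Type*} [Field F] {n k : ℕ}

/-! An MDS code with generator `[d·I | A]`, `d ≠ 0`, has all entries and all 2 × 2 minors of `A`
nonzero. If it is GRS, then `A` is a generalized Cauchy matrix `aᵢ bₘ / (yₘ - xᵢ)`, so the entrywise
inverse of `A` has rank at most 2 (`IsGRS.exists_mul_sub_eq`). Conversely, if the 3 × 3 minors of
that inverse containing a fixed 2 × 2 block vanish, the code is GRS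
(`IsSystematic.isGRS_of_invMinor`). For twisted codes these minors, cleared of denominators, are
polynomials in `η`. They cannot all be zero, or the code of `ηstar` would be GRS; a nonzero one is
the required `P`. Each `ηⱼ` occurs in a single row of the generator, so the systematic entries have
degree at most 1 in it; every term of the cleared minor multiplies six such entries. -/

theorem mem_grsCode {β v c : Fin n → F} :
    c ∈ grsCode k β v ↔ ∃ f : F[X], f.degree < k ∧ ∀ m, c m = f.eval (β m) * v m := by
  simp only [grsCode, Submodule.mem_map, evalMap, Polynomial.mem_degreeLT]
  constructor
  · rintro ⟨_, ⟨f, hf, rfl⟩, rfl⟩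
    exact ⟨f, hf, fun m => by simp [Matrix.vecMul_diagonal]⟩
  · rintro ⟨f, hf, hc⟩
    exact ⟨_, ⟨f, hf, rfl⟩, funext fun m => by simp [Matrix.vecMul_diagonal, hc]⟩

theorem finrank_grsCode_le (β v : Fin n → F) : Module.finrank F (grsCode k β v) ≤ k := by
  have : Module.Finite F (Polynomial.degreeLT F k) :=
    Module.Finite.equiv (Polynomial.degreeLTEquiv F k).symm
  refine (Submodule.finrank_map_le _ _).trans ((Submodule.finrank_map_le _ _).trans ?_)
  rw [(Polynomial.degreeLTEquiv F k).finrank_eq]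
  simp

theorem IsMDS.eq_zero_of_forall_mem [DecidableEq F] {𝒞 : Submodule F (Fin n → F)}
    (hC : IsMDS 𝒞) {x : Fin n → F} (hx : x ∈ 𝒞) {S : Finset (Fin n)}
    (hS : Module.finrank F 𝒞 ≤ S.card) (h0 : ∀ m ∈ S, x m = 0) : x = 0 := by
  by_contra hne
  have h1 : minDist 𝒞 ≤ hammingDist x 0 :=
    Nat.sInf_le ⟨x, hx, 0, 𝒞.zero_mem, hne, rfl⟩
  have h2 : hammingDist x 0 ≤ Sᶜ.card := by
    refine Finset.card_le_card fun m hm => ?_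
    rw [Finset.mem_compl]
    intro hmS
    simp [h0 m hmS] at hm
  rw [hC, Finset.card_compl, Fintype.card_fin] at *
  omega

/-- Codewords vanishing in `k` positions are zero. -/
def VanishesOfCardLE (𝒞 : Submodule F (Fin n → F)) (k : ℕ) : Prop :=
  ∀ x ∈ 𝒞, ∀ S : Finset (Fin n), k ≤ S.card → (∀ m ∈ S, x m = 0) → x = 0

/-- The rows of `D` are codewords of `𝒞` that restrict to `d` times the unit vectors on the first
`k` positions. -/
structure IsSystematic (𝒞 : Submodule F (Fin n → F)) (hkn : k ≤ n) (D : Matrix (Fin k) (Fin n) F)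
    (d : F) : Prop where
  ne_zero : d ≠ 0
  mem : ∀ i, D i ∈ 𝒞
  apply_castLE : ∀ i j, D i (Fin.castLE hkn j) = if i = j then d else 0

namespace IsSystematic

variable {𝒞 : Submodule F (Fin n → F)} {hkn : k ≤ n} {D : Matrix (Fin k) (Fin n) F} {d : F}

theorem le_of_forall_mem (hD : IsSystematic 𝒞 hkn D d) (hV : VanishesOfCardLE 𝒞 k)
    {ℬ : Submodule F (Fin n → F)} (hB : ∀ i, D i ∈ ℬ) : 𝒞 ≤ ℬ := by
  intro x hx
  have key : x - ∑ i, (x (Fin.castLE hkn i) / d) • D i = 0 := by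
    refine hV _ (𝒞.sub_mem hx (𝒞.sum_mem fun i _ => 𝒞.smul_mem _ (hD.mem i)))
      (Finset.univ.map (Fin.castLEEmb hkn)) (by simp) fun m hm => ?_
    obtain ⟨j, -, rfl⟩ := Finset.mem_map.1 hm
    simp [hD.apply_castLE, hD.ne_zero]
  rw [sub_eq_zero.1 key]
  exact ℬ.sum_mem fun i _ => ℬ.smul_mem _ (hB i)

/-- Row `i` already vanishes at the other `k - 1` systematic positions; one more zero would kill it.
-/
theorem apply_ne_zero (hD : IsSystematic 𝒞 hkn D d) (hV : VanishesOfCardLE 𝒞 k) (i : Fin k)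
    {m : Fin n} (hm : k ≤ m) : D i m ≠ 0 := by
  intro h0
  have hnot : m ∉ (Finset.univ.erase i).map (Fin.castLEEmb hkn) := by
    intro h
    obtain ⟨j, -, rfl⟩ := Finset.mem_map.1 h
    have := j.2
    simp at hm
    omega
  have := hV _ (hD.mem i) (Finset.cons m _ hnot) (by
    have := i.2
    rw [Finset.card_cons, Finset.card_map, Finset.card_erase_of_mem (Finset.mem_univ i),
      Finset.card_univ, Fintype.card_fin]
    omega) (by
    intro m' hm'
    rcases Finset.mem_cons.1 hm' with rfl | h
    · exact h0
    · obtain ⟨j, hj, rfl⟩ := Finset.mem_map.1 h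
      have hne : i ≠ j := fun h => by simp [h] at hj
      simp [hD.apply_castLE, hne])
  have h2 := congr_fun this (Fin.castLE hkn i)
  rw [hD.apply_castLE] at h2
  exact hD.ne_zero (by simpa using h2)

/-- Eliminating position `m` between rows `i` and `j` gives a nonzero codeword with `k - 1` zeros; a
vanishing minor would add `m'` as another. -/
theorem minor_ne_zero (hD : IsSystematic 𝒞 hkn D d) (hV : VanishesOfCardLE 𝒞 k) {i j : Fin k}
    (hij : i ≠ j) {m m' : Fin n} (hm : k ≤ m) (hm' : k ≤ m') (hmm : m ≠ m') :
    D i m * D j m' ≠ D i m' * D j m := by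
  intro h0
  have hnot : ∀ m : Fin n, k ≤ m →
      m ∉ ((Finset.univ.erase i).erase j).map (Fin.castLEEmb hkn) := by
    intro m hm h
    obtain ⟨j, -, rfl⟩ := Finset.mem_map.1 h
    have := j.2
    simp at hm
    omega
  have := hV (D j m • D i - D i m • D j)
    (𝒞.sub_mem (𝒞.smul_mem _ (hD.mem i)) (𝒞.smul_mem _ (hD.mem j)))
    (Finset.cons m' (Finset.cons m _ (hnot m hm))
      (by simpa [hmm.symm] using hnot m' hm')) (by
    have := i.2
    have := j.2
    have : (i : ℕ) ≠ j := fun h => hij (Fin.ext h)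
    rw [Finset.card_cons, Finset.card_cons, Finset.card_map,
      Finset.card_erase_of_mem (by simpa using hij.symm),
      Finset.card_erase_of_mem (Finset.mem_univ i), Finset.card_univ, Fintype.card_fin]
    omega) (by
    intro a ha
    rcases Finset.mem_cons.1 ha with rfl | h
    · simp only [Pi.sub_apply, Pi.smul_apply, smul_eq_mul]
      linear_combination -h0
    rcases Finset.mem_cons.1 h with rfl | h
    · simp only [Pi.sub_apply, Pi.smul_apply, smul_eq_mul]
      ring
    · obtain ⟨l, hl, rfl⟩ := Finset.mem_map.1 h
      simp only [Finset.mem_erase, Finset.mem_univ, and_true] at hl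
      simp [hD.apply_castLE, hl.1.symm, hl.2.symm])
  have h2 := congr_fun this (Fin.castLE hkn i)
  simp only [Pi.sub_apply, Pi.smul_apply, smul_eq_mul, hD.apply_castLE, Pi.zero_apply,
    if_neg hij.symm, if_true, mul_zero, sub_zero] at h2
  rcases mul_eq_zero.1 h2 with h | h
  · exact hD.apply_ne_zero hV j hm h
  · exact hD.ne_zero h

end IsSystematic

theorem eval_basis_mul_sub {ι : Type*} [DecidableEq ι] {s : Finset ι} {v : ι → F} {i : ι}
    (hi : i ∈ s) {x : F} (hx : x ≠ v i) :
    (Lagrange.basis s v i).eval x * (x - v i) =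
      (Lagrange.nodal s v).eval x * Lagrange.nodalWeight s v i := by
  rw [Lagrange.eval_basis_not_at_node hi hx]
  have : x - v i ≠ 0 := sub_ne_zero.2 hx
  field_simp

/-- The inverses of the non-systematic entries of a GRS code form a matrix of rank at most two. -/
theorem IsGRS.exists_mul_sub_eq {𝒞 : Submodule F (Fin n → F)} (hC : IsGRS 𝒞) (hkn : k < n)
    (hV : VanishesOfCardLE 𝒞 k) {D : Matrix (Fin k) (Fin n) F} {d : F}
    (hD : IsSystematic 𝒞 hkn.le D d) :
    ∃ (a x : Fin k → F) (b y : Fin n → F), ∀ i (m : Fin n), k ≤ m →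
      y m ≠ x i ∧ D i m * (y m - x i) = a i * b m := by
  obtain ⟨k', hk', β, v, hβ, hv, rfl⟩ := hC
  set γ : Fin k → F := fun i => β (Fin.castLE hkn.le i) with hγ
  have hγi : Function.Injective γ := hβ.comp (Fin.castLE_injective _)
  have hne : ∀ (m : Fin n) (i : Fin k), k ≤ m → β m ≠ γ i := by
    intro m i hm h
    have := i.2
    rw [hβ h] at hm
    simp at hm
    omega
  -- If `k' > k`, the degree-`k` polynomial vanishing at the first `k` points gives a nonzero
  -- codeword with `k` zeros.
  have hle : k' ≤ k := by
    by_contra! hlt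
    have h0 := hV (fun m => (Lagrange.nodal Finset.univ γ).eval (β m) * v m)
      (mem_grsCode.2 ⟨Lagrange.nodal Finset.univ γ, by simpa using hlt, fun m => rfl⟩)
      (Finset.univ.map (Fin.castLEEmb hkn.le)) (by simp) (by
        intro m hm
        obtain ⟨j, -, rfl⟩ := Finset.mem_map.1 hm
        have := Lagrange.eval_nodal_at_node (v := γ) (Finset.mem_univ j)
        simp only [hγ] at this
        simp [hγ, this])
    have h1 := congr_fun h0 ⟨k, hkn⟩
    rcases mul_eq_zero.1 h1 with h | h
    · exact Lagrange.eval_nodal_not_at_node (fun i _ => hne ⟨k, hkn⟩ i le_rfl) h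
    · exact hv _ h
  choose f hf hfe using fun i => mem_grsCode.1 (hD.mem i)
  refine ⟨fun i => (f i).eval (γ i) * Lagrange.nodalWeight Finset.univ γ i, γ,
    fun m => (Lagrange.nodal Finset.univ γ).eval (β m) * v m, β, fun i m hm => ⟨hne m i hm, ?_⟩⟩
  have hint : f i = C ((f i).eval (γ i)) * Lagrange.basis Finset.univ γ i := by
    rw [Lagrange.eq_interpolate (s := Finset.univ) (v := γ) (hγi.injOn)
      (f := f i) ((hf i).trans_le (by simpa using hle)), Lagrange.interpolate_apply,
      Finset.sum_eq_single i]
    · simp [Lagrange.eval_basis_self hγi.injOn]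
    · intro j _ hj
      have h1 := hfe i (Fin.castLE hkn.le j)
      rw [hD.apply_castLE, if_neg hj.symm] at h1
      have h2 : (f i).eval (γ j) = 0 := (mul_eq_zero.1 h1.symm).resolve_right (hv _)
      simp [h2]
    · simp
  rw [hfe, hint]
  have := eval_basis_mul_sub (Finset.mem_univ i) (hne m i hm)
  simp only [eval_mul, eval_C]
  linear_combination (f i).eval (γ i) * v m * this

/-- A code whose non-systematic part is a generalized Cauchy matrix is GRS. -/
theorem isGRS_of_mul_sub_eq {𝒞 : Submodule F (Fin n → F)} (hkn : k ≤ n)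
    (hV : VanishesOfCardLE 𝒞 k) (hk : Module.finrank F 𝒞 = k)
    {D : Matrix (Fin k) (Fin n) F} {d : F}
    (hD : IsSystematic 𝒞 hkn D d) {β l : Fin n → F} (hβ : Function.Injective β)
    (hl : ∀ m, l m ≠ 0) (h : ∀ i (m : Fin n), k ≤ m →
      D i m * (l (Fin.castLE hkn i) * l m * (β m - β (Fin.castLE hkn i))) = 1) :
    IsGRS 𝒞 := by
  set γ : Fin k → F := fun i => β (Fin.castLE hkn i) with hγ
  have hγi : Function.Injective γ := hβ.comp (Fin.castLE_injective _)
  have hne : ∀ (m : Fin n) (i : Fin k), k ≤ m → β m ≠ γ i := by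
    intro m i hm h
    have := i.2
    rw [hβ h] at hm
    simp at hm
    omega
  set w := Lagrange.nodalWeight Finset.univ γ
  have hw : ∀ i, w i ≠ 0 := fun i => Lagrange.nodalWeight_ne_zero hγi.injOn (Finset.mem_univ i)
  set M := Lagrange.nodal Finset.univ γ
  have hM : ∀ m : Fin n, k ≤ m → M.eval (β m) ≠ 0 := fun m hm =>
    Lagrange.eval_nodal_not_at_node (fun i _ => hne m i hm)
  -- These multipliers turn `(lᵢ wᵢ)⁻¹` times the `i`-th Lagrange basis polynomial into row `i` of
  -- `D`.
  let v : Fin n → F := fun m =>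
    if hm : (m : ℕ) < k then d * l m * w ⟨m, hm⟩ else (l m * M.eval (β m))⁻¹
  have hv : ∀ m, v m ≠ 0 := by
    intro m
    by_cases hm : (m : ℕ) < k
    · simpa [v, hm] using ⟨⟨hD.ne_zero, hl m⟩, hw _⟩
    · simpa [v, hm] using ⟨hM m (not_lt.1 hm), hl m⟩
  refine ⟨k, hkn, β, v, hβ, hv, ?_⟩
  refine Submodule.eq_of_le_of_finrank_le (hD.le_of_forall_mem hV fun i => ?_)
    ((finrank_grsCode_le β v).trans hk.ge)
  refine mem_grsCode.2 ⟨C ((l (Fin.castLE hkn i) * w i)⁻¹) * Lagrange.basis Finset.univ γ i, ?_, ?_⟩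
  · have hc : (l (Fin.castLE hkn i) * w i)⁻¹ ≠ 0 := inv_ne_zero (mul_ne_zero (hl _) (hw i))
    rw [degree_C_mul hc, Lagrange.degree_basis hγi.injOn (Finset.mem_univ i)]
    have := i.2
    simp only [Finset.card_univ, Fintype.card_fin]
    exact_mod_cast (by omega : k - 1 < k)
  · intro m
    by_cases hm : (m : ℕ) < k
    · obtain ⟨j, rfl⟩ : ∃ j, m = Fin.castLE hkn j := ⟨⟨m, hm⟩, rfl⟩
      rw [hD.apply_castLE]
      split_ifs with hij
      · subst hij
        have h1 : (Lagrange.basis Finset.univ γ i).eval (β (Fin.castLE hkn i)) = 1 :=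
          Lagrange.eval_basis_self hγi.injOn (Finset.mem_univ i)
        have := hw i
        have := hl (Fin.castLE hkn i)
        simp only [eval_mul, eval_C, h1, v, Fin.val_castLE, i.2, dif_pos, Fin.eta]
        field_simp
      · have h1 : (Lagrange.basis Finset.univ γ i).eval (β (Fin.castLE hkn j)) = 0 :=
          Lagrange.eval_basis_of_ne (v := γ) hij (Finset.mem_univ j)
        simp [h1]
    · have hm' := not_lt.1 hm
      have h1 := eval_basis_mul_sub (Finset.mem_univ i) (hne m i hm')
      have h2 := h i m hm'
      have h3 := hM m hm'
      have h4 := hw i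
      have h5 := hl m
      have h6 := hl (Fin.castLE hkn i)
      have h7 : β m - γ i ≠ 0 := sub_ne_zero.2 (hne m i hm')
      simp only [eval_mul, eval_C, v, hm, dif_neg, not_false_iff]
      change _ * (β m - γ i) = M.eval (β m) * w i at h1
      change _ * (_ * _ * (β m - γ i)) = 1 at h2
      rw [eq_div_of_mul_eq h7 h1, eq_div_of_mul_eq (mul_ne_zero (mul_ne_zero h6 h5) h7) h2]
      field_simp

/-- Pairwise independent vectors in the plane, at most `#F` in number, can be moved off the line at
infinity. -/
theorem exists_affine_chart [Fintype F] (hn : n ≤ Fintype.card F) (p q : Fin n → F)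
    (h0 : ∀ m, p m ≠ 0 ∨ q m ≠ 0)
    (hpq : ∀ a b, a ≠ b → p a * q b - p b * q a ≠ 0) :
    ∃ β l : Fin n → F, Function.Injective β ∧ (∀ m, l m ≠ 0) ∧
      ∀ a b, p a * q b - p b * q a = l a * l b * (β b - β a) := by
  -- The projective line has `#F + 1` points, so some point is missed. A determinant-one map sends
  -- it to infinity and preserves the brackets `p a * q b - p b * q a`.
  obtain ⟨z, z', u, u', hdet, hz⟩ : ∃ z z' u u' : F, z * u' - z' * u = 1 ∧
      ∀ m, z * p m + z' * q m ≠ 0 := by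
    classical
    let φ : Fin n → Option F := fun m => if p m = 0 then none else some (-(q m) / p m)
    have hφ : ¬ Function.Surjective φ := by
      intro hs
      have := Fintype.card_le_of_surjective φ hs
      simp at this
      omega
    obtain ⟨o, ho⟩ : ∃ o, ∀ m, φ m ≠ o := by simpa [Function.Surjective] using hφ
    cases o with
    | none =>
      refine ⟨1, 0, 0, 1, by ring, fun m hm => ho m ?_⟩
      simp only [one_mul, zero_mul, add_zero] at hm
      simp [φ, hm]
    | some c =>
      refine ⟨c, 1, -1, 0, by ring, fun m hm => ho m ?_⟩
      have hp : p m ≠ 0 := by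
        intro hp
        rcases h0 m with h | h
        · exact h hp
        · exact h (by simpa [hp] using hm)
      simp only [φ, hp, if_false, Option.some.injEq]
      field_simp
      linear_combination -hm
  have key : ∀ a b, p a * q b - p b * q a = (z * p a + z' * q a) * (z * p b + z' * q b) *
      ((u * p b + u' * q b) / (z * p b + z' * q b) -
        (u * p a + u' * q a) / (z * p a + z' * q a)) := by
    intro a b
    have clear : ∀ A B M N : F, A ≠ 0 → B ≠ 0 → A * B * (N / B - M / A) = A * N - B * M := by
      intro A B M N hA hB
      field_simp
    rw [clear _ _ _ _ (hz a) (hz b)]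
    linear_combination -(p a * q b - p b * q a) * hdet
  refine ⟨fun m => (u * p m + u' * q m) / (z * p m + z' * q m), fun m => z * p m + z' * q m,
    ?_, hz, key⟩
  intro a b hab
  by_contra hne
  refine hpq a b hne ?_
  simp only at hab
  rw [key, hab, sub_self, mul_zero]

end Codes

/-! ### Rank of the entrywise inverse as a criterion for GRS. -/

section InverseMinors

/-- The determinant of the matrix of inverses of the entries of a `3 × 3` matrix, times the product
of all its entries. -/
def invMinor {R : Type*} [CommRing R] (M : Matrix (Fin 3) (Fin 3) R) : R :=
  -- Indices wrap modulo 3: each entry is replaced by the product of the other two in its row,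
  -- avoiding division.
  (Matrix.of fun i j => M i (j + 1) * M i (j + 2)).det

theorem map_invMinor {R S : Type*} [CommRing R] [CommRing S] (f : R →+* S)
    (M : Matrix (Fin 3) (Fin 3) R) : f (invMinor M) = invMinor (M.map f) := by
  rw [invMinor, RingHom.map_det, invMinor]
  congr 1
  ext i j
  simp

variable {F : Type*} [Field F]

theorem invMinor_eq_mul_det_inv {M : Matrix (Fin 3) (Fin 3) F} (hM : ∀ i j, M i j ≠ 0) :
    invMinor M = (∏ i, ∏ j, M i j) * (Matrix.of fun i j => (M i j)⁻¹).det := by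
  rw [invMinor, ← Matrix.det_mul_column]
  congr 1
  ext i j
  have := hM i j
  fin_cases j <;> simp at this ⊢ <;> simp only [Fin.prod_univ_three] <;> field_simp

theorem invMinor_eq_zero {M : Matrix (Fin 3) (Fin 3) F} (hM : ∀ i j, M i j ≠ 0)
    {a x b y : Fin 3 → F} (h : ∀ i j, y j ≠ x i ∧ M i j * (y j - x i) = a i * b j) :
    invMinor M = 0 := by
  have hinv : ∀ i j, (M i j)⁻¹ = (y j - x i) * (a i)⁻¹ * (b j)⁻¹ := by
    intro i j
    have h1 := hM i j
    have h2 := sub_ne_zero.2 (h i j).1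
    have h3 := (h i j).2
    have h4 : a i * b j ≠ 0 := h3 ▸ mul_ne_zero h1 h2
    rw [mul_assoc, ← mul_inv, ← h3, mul_inv]
    field_simp
  rw [invMinor_eq_mul_det_inv hM, Matrix.det_fin_three]
  simp only [Matrix.of_apply, hinv]
  ring

variable {n k : ℕ}

/-- The bordered minors force rank 2. A rank-2 factorization attaches a plane vector to every
position so that brackets between systematic and other positions are the inverse entries; an affine
chart then yields the Cauchy form. -/
theorem IsSystematic.isGRS_of_invMinor [Fintype F] (hn : n ≤ Fintype.card F)
    {𝒞 : Submodule F (Fin n → F)} {hkn : k ≤ n}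
    (hV : VanishesOfCardLE 𝒞 k) (hk : Module.finrank F 𝒞 = k)
    {D : Matrix (Fin k) (Fin n) F} {d : F} (hD : IsSystematic 𝒞 hkn D d)
    {i₀ i₁ : Fin k} (hi : i₀ ≠ i₁) {m₀ m₁ : Fin n} (hm₀ : k ≤ m₀) (hm₁ : k ≤ m₁) (hm : m₀ ≠ m₁)
    (h : ∀ i (m : Fin n), k ≤ m → invMinor (D.submatrix ![i₀, i₁, i] ![m₀, m₁, m]) = 0) :
    IsGRS 𝒞 := by
  set B : Fin k → Fin n → F := fun i m => (D i m)⁻¹ with hB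
  have hB0 : ∀ i (m : Fin n), k ≤ m → B i m ≠ 0 := fun i m hm =>
    inv_ne_zero (hD.apply_ne_zero hV i hm)
  have hminor : ∀ i j, i ≠ j → ∀ m m' : Fin n, k ≤ m → k ≤ m' → m ≠ m' →
      B i m * B j m' - B i m' * B j m ≠ 0 := by
    intro i j hij m m' hm hm' hmm h0
    refine hD.minor_ne_zero hV hij hm hm' hmm (inv_injective ?_)
    simp only [mul_inv]
    exact sub_eq_zero.1 h0
  obtain ⟨Δ, hΔ⟩ : ∃ Δ, Δ = B i₀ m₀ * B i₁ m₁ - B i₀ m₁ * B i₁ m₀ := ⟨_, rfl⟩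
  have hΔ0 : Δ ≠ 0 := hΔ ▸ hminor _ _ hi _ _ hm₀ hm₁ hm
  -- Cramer coefficients of column `m` in terms of columns `m₀`, `m₁`, read off from rows `i₀`,
  -- `i₁`.
  let r : Fin n → F := fun m => (B i₀ m * B i₁ m₁ - B i₀ m₁ * B i₁ m) / Δ
  let s : Fin n → F := fun m => (B i₀ m₀ * B i₁ m - B i₀ m * B i₁ m₀) / Δ
  have hrank : ∀ i (m : Fin n), k ≤ m → B i m = B i m₀ * r m + B i m₁ * s m := by
    intro i m hmk
    have h1 := h i m hmk
    rw [invMinor_eq_mul_det_inv, mul_eq_zero] at h1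
    · rcases h1 with h1 | h1
      · simp only [Matrix.submatrix_apply, Finset.prod_eq_zero_iff] at h1
        obtain ⟨a, -, b, -, h1⟩ := h1
        refine absurd h1 (hD.apply_ne_zero hV _ ?_)
        fin_cases b <;> simpa
      · simp only [Matrix.det_fin_three, Matrix.of_apply, Matrix.submatrix_apply, Matrix.cons_val]
          at h1
        change B i₀ m₀ * B i₁ m₁ * B i m - B i₀ m₀ * B i₁ m * B i m₁ - B i₀ m₁ * B i₁ m₀ * B i m
          + B i₀ m₁ * B i₁ m * B i m₀ + B i₀ m * B i₁ m₀ * B i m₁ - B i₀ m * B i₁ m₁ * B i m₀ = 0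
          at h1
        simp only [r, s]
        field_simp
        rw [hΔ]
        linear_combination h1
    · intro a b
      refine hD.apply_ne_zero hV _ ?_
      fin_cases b <;> simpa
  -- The swap and sign in `(-s, r)` turn the dot product of the factorization into a bracket, so
  -- rows and columns become points of one plane.
  let p : Fin n → F := fun m => if hm : (m : ℕ) < k then B ⟨m, hm⟩ m₀ else -s m
  let q : Fin n → F := fun m => if hm : (m : ℕ) < k then B ⟨m, hm⟩ m₁ else r m
  have hmixed : ∀ a b : Fin n, ∀ ha : (a : ℕ) < k, ¬ (b : ℕ) < k →
      p a * q b - p b * q a = B ⟨a, ha⟩ b := by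
    intro a b ha hb
    rw [hrank _ b (not_lt.1 hb)]
    simp only [p, q, ha, hb, dif_pos, dif_neg, not_false_iff]
    ring
  have hpq : ∀ a b, a ≠ b → p a * q b - p b * q a ≠ 0 := by
    intro a b hab
    by_cases ha : (a : ℕ) < k <;> by_cases hb : (b : ℕ) < k
    · simp only [p, q, ha, hb, dif_pos]
      have := hminor ⟨a, ha⟩ ⟨b, hb⟩ (by simpa [Fin.ext_iff] using hab) m₀ m₁ hm₀ hm₁ hm
      intro h0
      exact this (by linear_combination h0)
    · rw [hmixed a b ha hb]
      exact hB0 _ _ (not_lt.1 hb)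
    · intro h0
      refine hB0 ⟨b, hb⟩ a (not_lt.1 ha) ?_
      rw [← hmixed b a hb ha]
      linear_combination -h0
    -- This minor of the inverse matrix is `Δ` times the bracket, up to sign.
    · have h1 := hminor i₀ i₁ hi a b (not_lt.1 ha) (not_lt.1 hb) hab
      rw [hrank i₀ a (not_lt.1 ha), hrank i₀ b (not_lt.1 hb), hrank i₁ a (not_lt.1 ha),
        hrank i₁ b (not_lt.1 hb)] at h1
      simp only [p, q, ha, hb, dif_neg, not_false_iff]
      intro h0
      exact h1 (by linear_combination (B i₀ m₀ * B i₁ m₁ - B i₀ m₁ * B i₁ m₀) * h0)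
  have hpq0 : ∀ m, p m ≠ 0 ∨ q m ≠ 0 := by
    intro m
    by_contra! hc
    obtain ⟨b, hb⟩ : ∃ b, m ≠ b := by
      by_cases hmm : m = m₀
      · exact ⟨m₁, hmm ▸ hm⟩
      · exact ⟨m₀, hmm⟩
    exact hpq m b hb (by simp [hc])
  obtain ⟨β, l, hβ, hl, hβl⟩ := exists_affine_chart hn p q hpq0 hpq
  refine isGRS_of_mul_sub_eq hkn hV hk hD hβ hl fun i m hmk => ?_
  rw [← hβl, hmixed (Fin.castLE hkn i) m i.2 (not_lt.2 hmk)]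
  exact mul_inv_cancel₀ (hD.apply_ne_zero hV i hmk)

end InverseMinors

/-! ### Polynomial generator matrices, degree bounds and dimension. -/

section Generator

/-- The adjugate of the first `k` columns of `G` times `G`: a generator matrix that is systematic up
to a scalar. -/
def systematicForm {R : Type*} [CommRing R] {n k : ℕ} (hkn : k ≤ n)
    (G : Matrix (Fin k) (Fin n) R) : Matrix (Fin k) (Fin n) R :=
  (G.submatrix id (Fin.castLE hkn)).adjugate * G

theorem map_systematicForm {R S : Type*} [CommRing R] [CommRing S] {n k : ℕ} (hkn : k ≤ n)
    (f : R →+* S) (G : Matrix (Fin k) (Fin n) R) :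
    (systematicForm hkn G).map f = systematicForm hkn (G.map f) := by
  have := RingHom.map_adjugate f (G.submatrix id (Fin.castLE hkn))
  simp only [RingHom.mapMatrix_apply] at this
  rw [systematicForm, Matrix.map_mul, this]
  rfl

theorem systematicForm_castLE {R : Type*} [CommRing R] {n k : ℕ} (hkn : k ≤ n)
    (G : Matrix (Fin k) (Fin n) R) (i j : Fin k) :
    systematicForm hkn G i (Fin.castLE hkn j) =
      if i = j then (G.submatrix id (Fin.castLE hkn)).det else 0 := by
  have := congr_fun₂ (Matrix.adjugate_mul (G.submatrix id (Fin.castLE hkn))) i j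
  rw [Matrix.smul_apply, Matrix.one_apply, smul_eq_mul, mul_ite, mul_one, mul_zero] at this
  exact this

theorem degreeOf_det_le {σ R ι : Type*} [CommRing R] [Fintype ι] [DecidableEq ι]
    (M : Matrix ι ι (MvPolynomial σ R)) (j : σ) (e : ι → ℕ)
    (hM : ∀ a b, (M a b).degreeOf j ≤ e a) : M.det.degreeOf j ≤ ∑ a, e a := by
  -- Transposing makes each Leibniz product run over rows, matching the row bounds `e`.
  rw [← Matrix.det_transpose, Matrix.det_apply]
  refine (MvPolynomial.degreeOf_sum_le _ _ _).trans (Finset.sup_le fun τ _ => ?_)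
  have hs : ∀ p : MvPolynomial σ R, (Equiv.Perm.sign τ • p).degreeOf j = p.degreeOf j := by
    intro p
    rcases Int.units_eq_one_or (Equiv.Perm.sign τ) with h | h <;> simp [h, MvPolynomial.degreeOf_neg]
  rw [hs]
  exact (MvPolynomial.degreeOf_prod_le _ _ _).trans (Finset.sum_le_sum fun a _ => hM _ _)

/-- By Cramer's rule each entry is a single `k × k` determinant with one column replaced, so each
row contributes its degree only once. -/
theorem degreeOf_systematicForm_le {σ R : Type*} [CommRing R] {n k : ℕ} (hkn : k ≤ n)
    (G : Matrix (Fin k) (Fin n) (MvPolynomial σ R)) (j : σ) (e : Fin k → ℕ)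
    (hG : ∀ a m, (G a m).degreeOf j ≤ e a) (i : Fin k) (m : Fin n) :
    (systematicForm hkn G i m).degreeOf j ≤ ∑ a, e a := by
  have : systematicForm hkn G i m =
      ((G.submatrix id (Fin.castLE hkn)).updateCol i fun a => G a m).det := by
    rw [← Matrix.cramer_apply, Matrix.cramer_eq_adjugate_mulVec]
    rfl
  rw [this]
  refine degreeOf_det_le _ _ _ fun a b => ?_
  rw [Matrix.updateCol_apply]
  split_ifs
  · exact hG a m
  · exact hG a _

theorem degreeOf_invMinor_le {σ R : Type*} [CommRing R]
    (M : Matrix (Fin 3) (Fin 3) (MvPolynomial σ R)) (j : σ)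
    (hM : ∀ a b, (M a b).degreeOf j ≤ 1) : (invMinor M).degreeOf j ≤ 6 := by
  refine (degreeOf_det_le _ j (fun _ => 2) fun a b => ?_).trans (by simp)
  exact (MvPolynomial.degreeOf_mul_le _ _ _).trans (add_le_add (hM _ _) (hM _ _))

variable {F : Type*} [Field F] {n k ℓ : ℕ}

/-- The generator matrix of the twisted Reed--Solomon code, with coefficients in an algebra. -/
def genMatrix {R : Type*} [CommRing R] [Algebra F R] (α : Fin n → F) (t : Fin ℓ → ℕ)
    (h : Fin ℓ → Fin k) (x : Fin ℓ → R) : Matrix (Fin k) (Fin n) R :=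
  Matrix.of fun i m => algebraMap F R (α m ^ (i : ℕ)) +
    ∑ j, if h j = i then x j * algebraMap F R (α m ^ (k - 1 + t j)) else 0

theorem map_genMatrix_X (α : Fin n → F) (t : Fin ℓ → ℕ) (h : Fin ℓ → Fin k) (η : Fin ℓ → F) :
    (genMatrix α t h (MvPolynomial.X (R := F))).map (MvPolynomial.eval η) = genMatrix α t h η := by
  ext i m
  simp [genMatrix, MvPolynomial.algebraMap_eq, apply_ite (MvPolynomial.eval η)]

theorem degreeOf_genMatrix_X_le (α : Fin n → F) (t : Fin ℓ → ℕ) (h : Fin ℓ → Fin k) (j : Fin ℓ)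
    (i : Fin k) (m : Fin n) :
    (genMatrix α t h (MvPolynomial.X (R := F)) i m).degreeOf j ≤ if h j = i then 1 else 0 := by
  rw [genMatrix, Matrix.of_apply]
  refine (MvPolynomial.degreeOf_add_le _ _ _).trans (max_le ?_ ?_)
  · rw [MvPolynomial.algebraMap_eq, MvPolynomial.degreeOf_C]
    exact Nat.zero_le _
  · refine (MvPolynomial.degreeOf_sum_le _ _ _).trans (Finset.sup_le fun a _ => ?_)
    split_ifs with h1 h2 h2
    · refine (MvPolynomial.degreeOf_mul_C_le _ _ _).trans ?_
      rw [MvPolynomial.degreeOf_X]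
      split_ifs <;> simp
    · refine (MvPolynomial.degreeOf_mul_C_le _ _ _).trans ?_
      rw [MvPolynomial.degreeOf_X_of_ne]
      rintro rfl
      exact h2 h1
    · simp
    · simp

theorem vecMul_genMatrix (α : Fin n → F) (t : Fin ℓ → ℕ) (h : Fin ℓ → Fin k) (η : Fin ℓ → F)
    (f : Fin k → F) :
    Matrix.vecMul f (genMatrix α t h η) = evalMap α (twistedPoly t h η f) := by
  ext m
  simp only [Matrix.vecMul, dotProduct, genMatrix, Matrix.of_apply, Algebra.algebraMap_self,
    RingHom.id_apply, evalMap, LinearMap.pi_apply, leval_apply, twistedPoly, eval_add,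
    eval_finsetSum, eval_mul, eval_C, eval_pow, eval_X, mul_add, Finset.sum_add_distrib,
    Finset.mul_sum]
  rw [Finset.sum_comm]
  congr 1
  refine Finset.sum_congr rfl fun j _ => ?_
  rw [Finset.sum_eq_single (h j)]
  · simp only [if_true]
    ring
  · intro i _ hi
    simp [hi.symm]
  · simp

theorem twistedRSCode_eq_range (α : Fin n → F) (t : Fin ℓ → ℕ) (h : Fin ℓ → Fin k)
    (η : Fin ℓ → F) :
    twistedRSCode α t h η = LinearMap.range (Matrix.vecMulLinear (genMatrix α t h η)) := by
  ext x
  simp only [LinearMap.mem_range, Matrix.vecMulLinear_apply, vecMul_genMatrix, twistedRSCode,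
    Submodule.mem_map]
  constructor
  · rintro ⟨_, ⟨f, rfl⟩, rfl⟩
    exact ⟨f, rfl⟩
  · rintro ⟨f, rfl⟩
    exact ⟨_, ⟨f, rfl⟩, rfl⟩

/-- Twisted polynomials have degree below `n`, so evaluation at `n` points determines them; all
twists have degree at least `k`, so the lower coefficients recover `f`. -/
theorem vecMulLinear_genMatrix_injective (hkn : k < n) {α : Fin n → F}
    (hα : Function.Injective α) {t : Fin ℓ → ℕ} (ht : ∀ j, 1 ≤ t j ∧ t j ≤ n - k)
    (h : Fin ℓ → Fin k) (η : Fin ℓ → F) :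
    Function.Injective (Matrix.vecMulLinear (genMatrix α t h η)) := by
  rw [← LinearMap.ker_eq_bot, LinearMap.ker_eq_bot']
  intro f hf
  rw [Matrix.vecMulLinear_apply, vecMul_genMatrix] at hf
  have hdeg : (twistedPoly t h η f).degree < n := by
    rw [← Polynomial.mem_degreeLT]
    refine Submodule.add_mem _ (Submodule.sum_mem _ fun i _ => ?_)
      (Submodule.sum_mem _ fun j _ => ?_)
    · rw [Polynomial.mem_degreeLT]
      refine (degree_C_mul_X_pow_le _ _).trans_lt ?_
      exact_mod_cast i.2.trans hkn
    · rw [Polynomial.mem_degreeLT]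
      refine (degree_C_mul_X_pow_le _ _).trans_lt ?_
      have := (ht j).2
      have := (h j).2
      exact_mod_cast (by omega : k - 1 + t j < n)
  have hzero : twistedPoly t h η f = 0 :=
    eq_zero_of_degree_lt_of_eval_index_eq_zero (s := Finset.univ) (v := α) hα.injOn
      (by simpa using hdeg) fun m _ => congr_fun hf m
  ext i
  have hc := congr_arg (fun p => p.coeff (i : ℕ)) hzero
  simp only [twistedPoly, coeff_add, finsetSum_coeff, coeff_C_mul_X_pow, coeff_zero] at hc
  rw [Finset.sum_eq_single i, Finset.sum_eq_zero, if_pos rfl, add_zero] at hc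
  · exact hc
  · intro j _
    have := (ht j).1
    have := i.2
    rw [if_neg (by omega)]
  · intro j _ hj
    rw [if_neg fun h => hj (Fin.ext h.symm)]
  · simp

theorem finrank_twistedRSCode (hkn : k < n) {α : Fin n → F}
    (hα : Function.Injective α) {t : Fin ℓ → ℕ} (ht : ∀ j, 1 ≤ t j ∧ t j ≤ n - k)
    (h : Fin ℓ → Fin k) (η : Fin ℓ → F) : Module.finrank F (twistedRSCode α t h η) = k := by
  rw [twistedRSCode_eq_range,
    LinearMap.finrank_range_of_inj (vecMulLinear_genMatrix_injective hkn hα ht h η)]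
  simp

theorem IsMDS.vanishesOfCardLE [DecidableEq F] {𝒞 : Submodule F (Fin n → F)} (hC : IsMDS 𝒞)
    (hk : Module.finrank F 𝒞 = k) : VanishesOfCardLE 𝒞 k :=
  fun _ hx _ hS h0 => hC.eq_zero_of_forall_mem hx (hk.trans_le hS) h0

theorem isSystematic_systematicForm (hkn : k < n) {α : Fin n → F}
    (hα : Function.Injective α) {t : Fin ℓ → ℕ} (ht : ∀ j, 1 ≤ t j ∧ t j ≤ n - k)
    (h : Fin ℓ → Fin k) (η : Fin ℓ → F) (hV : VanishesOfCardLE (twistedRSCode α t h η) k) :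
    IsSystematic (twistedRSCode α t h η) hkn.le (systematicForm hkn.le (genMatrix α t h η))
      ((genMatrix α t h η).submatrix id (Fin.castLE hkn.le)).det where
  ne_zero := by
    -- A singular systematic block would give a nonzero message whose codeword vanishes at the first
    -- `k` positions.
    intro h0
    obtain ⟨f, hf, hf0⟩ := Matrix.exists_vecMul_eq_zero_iff.2 h0
    refine hf (vecMulLinear_genMatrix_injective hkn hα ht h η ?_)
    rw [map_zero]
    refine hV _ ?_ (Finset.univ.map (Fin.castLEEmb hkn.le)) (by simp) fun m hm => ?_
    · rw [twistedRSCode_eq_range]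
      exact LinearMap.mem_range_self _ _
    · obtain ⟨j, -, rfl⟩ := Finset.mem_map.1 hm
      exact congr_fun hf0 j
  mem i := by
    rw [twistedRSCode_eq_range]
    exact ⟨((genMatrix α t h η).submatrix id (Fin.castLE hkn.le)).adjugate i, rfl⟩
  apply_castLE := systematicForm_castLE _ _

end Generator

end TwistedRS

open TwistedRS in
theorem mainTheorem8 {F : Type*} [Field F] [Finite F] [DecidableEq F]
    (n k ℓ : ℕ) (hℓ : 0 < ℓ) (hkn : k < n) (hmin : 3 ≤ min k (n - k))
    (α : Fin n → F) (hα : Function.Injective α)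
    (t : Fin ℓ → ℕ) (ht : ∀ j, 1 ≤ t j ∧ t j ≤ n - k)
    (h : Fin ℓ → Fin k)
    (hth : Function.Injective fun j => (h j, t j))
    (hex : ∃ ηstar : Fin ℓ → F,
      TwistedRS.IsMDS (TwistedRS.twistedRSCode α t h ηstar) ∧
        ¬ TwistedRS.IsGRS (TwistedRS.twistedRSCode α t h ηstar)) :
    ∃ P : MvPolynomial (Fin ℓ) F, P ≠ 0 ∧ (∀ j, P.degreeOf j ≤ 6) ∧
      ∀ η : Fin ℓ → F,
        TwistedRS.IsMDS (TwistedRS.twistedRSCode α t h η) →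
        TwistedRS.IsGRS (TwistedRS.twistedRSCode α t h η) →
          MvPolynomial.eval η P = 0 := by
  have := Fintype.ofFinite F
  have hn : n ≤ Fintype.card F := by simpa using Fintype.card_le_of_injective α hα
  obtain ⟨hk3, hnk3⟩ := le_min_iff.1 hmin
  have hV : ∀ η, IsMDS (twistedRSCode α t h η) → VanishesOfCardLE (twistedRSCode α t h η) k :=
    fun η hη => hη.vanishesOfCardLE (finrank_twistedRSCode hkn hα ht h η)
  let i₀ : Fin k := ⟨0, by omega⟩
  let i₁ : Fin k := ⟨1, by omega⟩
  let m₀ : Fin n := ⟨k, by omega⟩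
  let m₁ : Fin n := ⟨k + 1, by omega⟩
  let P : Fin k → Fin n → MvPolynomial (Fin ℓ) F := fun i m =>
    invMinor ((systematicForm hkn.le (genMatrix α t h MvPolynomial.X)).submatrix
      ![i₀, i₁, i] ![m₀, m₁, m])
  have heval : ∀ i m η, MvPolynomial.eval η (P i m) =
      invMinor ((systematicForm hkn.le (genMatrix α t h η)).submatrix
        ![i₀, i₁, i] ![m₀, m₁, m]) := by
    intro i m η
    rw [map_invMinor, ← Matrix.submatrix_map, map_systematicForm, map_genMatrix_X]
  obtain ⟨i, m, hm, hne⟩ : ∃ i, ∃ m : Fin n, k ≤ m ∧ P i m ≠ 0 := by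
    obtain ⟨η, hmds, hgrs⟩ := hex
    by_contra! hall
    refine hgrs ((isSystematic_systematicForm hkn hα ht h η (hV η hmds)).isGRS_of_invMinor hn
      (hV η hmds) (finrank_twistedRSCode hkn hα ht h η) (i₀ := i₀) (i₁ := i₁) (m₀ := m₀) (m₁ := m₁)
      (by simp [i₀, i₁]) le_rfl (Nat.le_succ k) (by simp [m₀, m₁]) fun i m hm => ?_)
    rw [← heval, hall i m hm, map_zero]
  refine ⟨P i m, hne, fun j => degreeOf_invMinor_le _ j fun a b => ?_, fun η hmds hgrs => ?_⟩
  -- The row bounds sum to 1, since only row `h j` involves the variable `j`.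
  · exact (degreeOf_systematicForm_le _ _ _ _ (degreeOf_genMatrix_X_le α t h j) _ _).trans (by simp)
  · have hD := isSystematic_systematicForm hkn hα ht h η (hV η hmds)
    obtain ⟨a, x, b, y, hxy⟩ := hgrs.exists_mul_sub_eq hkn (hV η hmds) hD
    have hcol : ∀ c, k ≤ (![m₀, m₁, m] c : ℕ) := by
      intro c
      fin_cases c
      exacts [le_rfl, Nat.le_succ k, hm]
    rw [heval]
    exact invMinor_eq_zero (fun r c => hD.apply_ne_zero (hV η hmds) _ (hcol c))
      (a := a ∘ ![i₀, i₁, i]) (x := x ∘ ![i₀, i₁, i]) (b := b ∘ ![m₀, m₁, m])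
      (y := y ∘ ![m₀, m₁, m]) fun r c => hxy _ _ (hcol c)
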